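/- **Boxes and optimal boxes.** A box in $\mathbb{R}^n$ is $P=\prod_{i=1}^n[l_i,u_i]$ with $l_i\le u_i$; its total width is $|P|=\sum_i(u_i-l_i)$, and for $r\ge 0$ its $r$-enlargement is $P^r=\prod_i[l_i-r,u_i+r]$. For a box $V$ and $\pi\ge0$ let $N=B(V,\pi)=\prod_i(l_i-\pi,u_i+\pi)$. Let $X\subset\mathbb{R}^n$ be finite and nonempty. For a box $W=\prod_i[l_i,u_i]$ with $V\subseteq W\subseteq\overline N$ and $\alpha\in[0,1]$, the point-cover cost is $$C_\alpha(W,N)=-\alpha\sum_{x\in X\cap N}w_x+(1-\alpha)|W|,\qquad w_x=\min\big(\{x_i-l_i\}_i\cup\{u_i-x_i\}_i\cup\{0\}\big).$$ For a grid of half-open cubes ("pixels") of side length $\mathcal H>0$ (with any origin), let $\bar X$ be the set of centroids $m_\sigma$ of the pixels $\sigma$ that contain a point of $X$, with the Euclidean distance, and let $\theta(\sigma)=|X\cap\sigma|$. The pixel-cover cost is $$\overline C_\alpha(W,N)=-\alpha\sum_{m_\sigma\in\bar X\cap N}w_\sigma\,\theta(\sigma)+(1-\alpha)|W|,\qquad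 w_\sigma=\min\big(\{m_\sigma^i-l_i\}_i\cup\{u_i-m_\sigma^i\}_i\cup\{\tfrac12\mathcal H\}\big).$$ In both cases, among the boxes $W$ with $V\subseteq W\subseteq\overline N$ of minimal cost there is a largest one, denoted $M_{\pi,\alpha}(V)$ and $\overline M_{\pi,\alpha}(V)$ respectively; both grow with $\pi$ and $\alpha$. **Box filtrations.** Let initial boxes $V(x)\ni x$ $(x\in X)$ and $V(m_\sigma)$ $(m_\sigma\in\bar X)$ be given which are the same in both settings: $V(m_\sigma)=V(x)$ whenever $x\in X\cap\sigma$. For $(r,\pi,\alpha)\in\mathbb{R}_{\ge0}\times\mathbb{R}_{\ge0}\times[0,1]$, let the $r$-enlarged point-cover box filtration $r\text{-}\mathrm{BoxF}(X,\pi,\alpha)$ be the simplicial complex with vertex set $X$ that is the nerve of the boxes $M_{\pi,\alpha}(V(x))^r$, and let the $r$-enlarged pixel-cover box filtration $r\text{-}\overline{\mathrm{BoxF}}(\bar X,\pi,\alpha)$ be the complex with vertex set $\bar X$ that is the nerve of the boxes $\overline M_{\pi,\alpha}(V(m_\sigma))^r$; $r=0$ gives the box filtrations themselves. Their homology in a degree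 $d$ with coefficients in a field, with the maps induced by the inclusions, gives persistence modules over $(r,\pi,\alpha)$. Two such modules $A,B$ are $\delta$-interleaved if, with the shift $p=(r,\pi,\alpha)\mapsto p+\delta=(r+\delta,\pi+\delta,\min\{\alpha+\delta,1\})$, there are natural maps $A_p\to B_{p+\delta}$ and $B_p\to A_{p+\delta}$ whose composites are the structure maps $A_p\to A_{p+2\delta}$ and $B_p\to B_{p+2\delta}$. **Theorem.** For all $n$ and all constants $\mathcal L,c\ge0$ there is a constant $C$, depending only on $n,\mathcal L,c$, with the following property. Let $X\subset\mathbb{R}^n$ be finite and nonempty, such that for any two nested boxes $P\subseteq Q$ the number of points of $X$ that lie in the interior $\prod_i(l_i,u_i)$ of $Q$ but not in that of $P$ is at most $\mathcal L(|Q|-|P|)+2cn$. Let $\bar X$ be a pixel discretization of $X$ with pixels of side length $\mathcal H>0$, let $\epsilon>0$, and suppose that $\mathcal H\sqrt n\le\epsilon$, $d_{GH}(X,\bar X)<\epsilon$ and $0.5\,\mathcal H\mathcal L<1$. Then, for any choice of initial boxes as above, any field and any degree, the persistence modules $H(r\text{-}\mathrm{BoxF}(X,\pi,\alpha))$ and $H(r\text{-}\overline{\mathrm{BoxF}}(\bar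 X,\pi,\alpha))$ over $(r,\pi,\alpha)$ are $C\max\{\epsilon^{1/2},\epsilon\}$-interleaved. In particular the box filtrations ($r=0$) are interleaved up to enlarging the boxes by at most $C\max\{\epsilon^{1/2},\epsilon\}$ at each of the two maps. -/

import Mathlib

open CategoryTheory
open scoped NNReal

noncomputable section

namespace BoxFiltration

/-- Points of `ℝⁿ` with the Euclidean metric. -/
abbrev Pt (n : ℕ) : Type := EuclideanSpace ℝ (Fin n)

/-! ### Boxes -/

/-- A box `[l₁, u₁] × ⋯ × [lₙ, uₙ]` with `lᵢ ≤ uᵢ`. -/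
@[ext]
structure Box (n : ℕ) where
  lo : Fin n → ℝ
  hi : Fin n → ℝ
  lo_le_hi : ∀ i, lo i ≤ hi i

namespace Box

variable {n : ℕ}

/-- `P ≤ Q` means that the box `P` is contained in the box `Q`. -/
instance : PartialOrder (Box n) where
  le P Q := ∀ i, Q.lo i ≤ P.lo i ∧ P.hi i ≤ Q.hi i
  le_refl P i := ⟨le_refl _, le_refl _⟩
  le_trans P Q R h₁ h₂ i := ⟨(h₂ i).1.trans (h₁ i).1, (h₁ i).2.trans (h₂ i).2⟩
  le_antisymm P Q h₁ h₂ :=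
    Box.ext (funext fun i => le_antisymm (h₂ i).1 (h₁ i).1)
      (funext fun i => le_antisymm (h₁ i).2 (h₂ i).2)

/-- The set of points of a (closed) box. -/
def toSet (P : Box n) : Set (Pt n) := {z | ∀ i, P.lo i ≤ z i ∧ z i ≤ P.hi i}

/-- The open box `(l₁, u₁) × ⋯ × (lₙ, uₙ)`. -/
def openSet (P : Box n) : Set (Pt n) := {z | ∀ i, P.lo i < z i ∧ z i < P.hi i}

/-- The total width `∑ᵢ (uᵢ - lᵢ)`. -/
def width (P : Box n) : ℝ := ∑ i, (P.hi i - P.lo i)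

/-- The box `[l₁ - r, u₁ + r] × ⋯ × [lₙ - r, uₙ + r]`. -/
def enlarge (P : Box n) (r : ℝ≥0) : Box n where
  lo i := P.lo i - r
  hi i := P.hi i + r
  lo_le_hi i := by have := P.lo_le_hi i; have := r.2; simp only [NNReal.val_eq_coe] at this; linarith

/-- The open neighborhood `B(V, π) = (l₁ - π, u₁ + π) × ⋯ × (lₙ - π, uₙ + π)`. -/
def nbhd (V : Box n) (π : ℝ≥0) : Set (Pt n) := (V.enlarge π).openSet

/-- The union of two boxes, that is, the smallest box containing both. -/
def join (P Q : Box n) : Box n where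
  lo i := min (P.lo i) (Q.lo i)
  hi i := max (P.hi i) (Q.hi i)
  lo_le_hi i := (min_le_left _ _).trans ((P.lo_le_hi i).trans (le_max_left _ _))

/-- The intersection of two boxes that contain a common box. -/
def meet {V P Q : Box n} (hP : V ≤ P) (hQ : V ≤ Q) : Box n where
  lo i := max (P.lo i) (Q.lo i)
  hi i := min (P.hi i) (Q.hi i)
  lo_le_hi i := (max_le (hP i).1 (hQ i).1).trans ((V.lo_le_hi i).trans (le_min (hP i).2 (hQ i).2))

theorem enlarge_mono {P Q : Box n} (h : P ≤ Q) {r s : ℝ≥0} (hrs : r ≤ s) :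
    P.enlarge r ≤ Q.enlarge s := by
  intro i
  have h' : (r : ℝ) ≤ s := by exact_mod_cast hrs
  have := h i
  simp only [enlarge]
  constructor <;> linarith

theorem le_enlarge (P : Box n) (r : ℝ≥0) : P ≤ P.enlarge r := by
  intro i
  have : (0 : ℝ) ≤ r := r.2
  simp only [enlarge]
  constructor <;> linarith

theorem toSet_mono {P Q : Box n} (h : P ≤ Q) : P.toSet ⊆ Q.toSet :=
  fun _ hz i => ⟨(h i).1.trans (hz i).1, (hz i).2.trans (h i).2⟩

theorem openSet_mono {P Q : Box n} (h : P ≤ Q) : P.openSet ⊆ Q.openSet :=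
  fun _ hz i => ⟨(h i).1.trans_lt (hz i).1, (hz i).2.trans_le (h i).2⟩

theorem le_join_left (P Q : Box n) : P ≤ P.join Q :=
  fun _ => ⟨min_le_left _ _, le_max_left _ _⟩

theorem le_join_right (P Q : Box n) : Q ≤ P.join Q :=
  fun _ => ⟨min_le_right _ _, le_max_right _ _⟩

theorem join_le {P Q R : Box n} (h₁ : P ≤ R) (h₂ : Q ≤ R) : P.join Q ≤ R :=
  fun i => ⟨le_min (h₁ i).1 (h₂ i).1, max_le (h₁ i).2 (h₂ i).2⟩

theorem meet_le_left {V P Q : Box n} (hP : V ≤ P) (hQ : V ≤ Q) : meet hP hQ ≤ P :=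
  fun _ => ⟨le_max_left _ _, min_le_left _ _⟩

theorem le_meet {V P Q : Box n} (hP : V ≤ P) (hQ : V ≤ Q) : V ≤ meet hP hQ :=
  fun i => ⟨max_le (hP i).1 (hQ i).1, le_min (hP i).2 (hQ i).2⟩

theorem width_mono {P Q : Box n} (h : P ≤ Q) : P.width ≤ Q.width := by
  apply Finset.sum_le_sum
  intro i _
  have := h i
  linarith

theorem width_join_add_width_meet {V P Q : Box n} (hP : V ≤ P) (hQ : V ≤ Q) :
    (P.join Q).width + (meet hP hQ).width = P.width + Q.width := by
  simp only [width, ← Finset.sum_add_distrib]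
  refine Finset.sum_congr rfl fun i _ => ?_
  simp only [join, meet]
  have h₁ := min_add_max (P.lo i) (Q.lo i)
  have h₂ := min_add_max (P.hi i) (Q.hi i)
  linarith

theorem eq_of_le_of_width_le {P Q : Box n} (h : P ≤ Q) (hw : Q.width ≤ P.width) : P = Q := by
  have h₀ : ∀ i ∈ Finset.univ, P.hi i - P.lo i ≤ Q.hi i - Q.lo i := by
    intro i _
    have := h i
    linarith
  have h₁ := (Finset.sum_eq_sum_iff_of_le h₀).1 (le_antisymm (width_mono h) hw)
  apply le_antisymm h
  intro i
  have h₂ := h₁ i (Finset.mem_univ i)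
  have h₃ := h i
  constructor <;> linarith

end Box

/-! ### The box expansion linear program

The point cover and the pixel cover use the same linear program, with different data: the finite
set of sites `z` (the points of `X`, respectively the centroids of the nonempty pixels), their
multiplicities `θ(z)` (`1`, respectively the number of points of `X` in the pixel), and the upper
bound on the weights (`0`, respectively half of the side length of the pixels). -/

/-- The data of a box expansion problem. -/
structure Sites (n : ℕ) where
  pts : Finset (Pt n)
  mult : Pt n → ℕ
  cap : ℝ

variable {n : ℕ}

/-- The weight of the site `z` with respect to the box `P = ∏ [lᵢ, uᵢ]`: the largest value allowed
by the linear program, `min ({zᵢ - lᵢ | i} ∪ {uᵢ - zᵢ | i} ∪ {cap})`. -/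
def weight (cap : ℝ) (z : Pt n) (P : Box n) : ℝ :=
  (Finset.univ : Finset (Fin n)).fold min cap fun i => min (z i - P.lo i) (P.hi i - z i)

open scoped Classical in
/-- The cost `-α ∑_{z ∈ N} w_z θ(z) + (1 - α) |P|` of the box `P`, for the neighborhood `N`. -/
def Sites.cost (T : Sites n) (α : ℝ) (N : Set (Pt n)) (P : Box n) : ℝ :=
  -α * ∑ z ∈ T.pts with z ∈ N, weight T.cap z P * T.mult z + (1 - α) * P.width

/-- `W` is an optimal solution for the input box `V` and the neighborhood `N = B(V, π)`: it
minimizes the cost among the boxes that contain `V` and lie in (the closure of) `N`. -/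
structure Sites.IsOptimal (T : Sites n) (α : ℝ) (V : Box n) (π : ℝ≥0) (W : Box n) : Prop where
  le : V ≤ W
  le_enlarge : W ≤ V.enlarge π
  cost_le : ∀ W' : Box n, V ≤ W' → W' ≤ V.enlarge π →
    T.cost α (V.nbhd π) W ≤ T.cost α (V.nbhd π) W'

/-- `W` is the largest optimal solution. -/
structure Sites.IsLargestOptimal (T : Sites n) (α : ℝ) (V : Box n) (π : ℝ≥0) (W : Box n) :
    Prop where
  isOptimal : T.IsOptimal α V π W
  le_of_isOptimal : ∀ W' : Box n, T.IsOptimal α V π W' → W' ≤ W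

/-! ### Existence and monotonicity of largest optimal solutions -/

theorem weight_mono (b : ℝ) (z : Pt n) {P Q : Box n} (h : P ≤ Q) : weight b z P ≤ weight b z Q := by
  rw [weight, weight, Finset.le_fold_min]
  have h₀ := (Finset.le_fold_min (s := (Finset.univ : Finset (Fin n))) (b := b)
    (f := fun i => min (z i - P.lo i) (P.hi i - z i)) _).1 le_rfl
  refine ⟨h₀.1, fun i hi => (h₀.2 i hi).trans ?_⟩
  have := h i
  exact min_le_min (by linarith) (by linarith)

theorem weight_add_le (b : ℝ) (z : Pt n) {V P Q : Box n} (hP : V ≤ P) (hQ : V ≤ Q) :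
    weight b z P + weight b z Q ≤ weight b z (P.join Q) + weight b z (Box.meet hP hQ) := by
  have hm : min (weight b z P) (weight b z Q) ≤ weight b z (Box.meet hP hQ) := by
    have h₁ := (Finset.le_fold_min (s := (Finset.univ : Finset (Fin n))) (b := b)
      (f := fun i => min (z i - P.lo i) (P.hi i - z i)) (weight b z P)).1 le_rfl
    have h₂ := (Finset.le_fold_min (s := (Finset.univ : Finset (Fin n))) (b := b)
      (f := fun i => min (z i - Q.lo i) (Q.hi i - z i)) (weight b z Q)).1 le_rfl
    rw [weight.eq_def b z (Box.meet hP hQ), Finset.le_fold_min]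
    refine ⟨(min_le_left _ _).trans h₁.1, fun i hi => ?_⟩
    have h₃ := le_min_iff.1 (h₁.2 i hi)
    have h₄ := le_min_iff.1 (h₂.2 i hi)
    simp only [Box.meet]
    refine le_min ?_ ?_
    · rcases le_total (P.lo i) (Q.lo i) with h | h
      · rw [max_eq_right h]; exact (min_le_right _ _).trans h₄.1
      · rw [max_eq_left h]; exact (min_le_left _ _).trans h₃.1
    · rcases le_total (P.hi i) (Q.hi i) with h | h
      · rw [min_eq_left h]; exact (min_le_left _ _).trans h₃.2
      · rw [min_eq_right h]; exact (min_le_right _ _).trans h₄.2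
  have hj : max (weight b z P) (weight b z Q) ≤ weight b z (P.join Q) :=
    max_le (weight_mono b z (P.le_join_left Q)) (weight_mono b z (P.le_join_right Q))
  have := min_add_max (weight b z P) (weight b z Q)
  linarith

theorem Sites.IsOptimal.join {T : Sites n} {α α' : ℝ} (h0 : 0 ≤ α) (hα : α ≤ α')
    {π π' : ℝ≥0} (hπ : π ≤ π') {V W W' : Box n} (hW : T.IsOptimal α V π W)
    (hW' : T.IsOptimal α' V π' W') : T.IsOptimal α' V π' (W.join W') := by
  classical
  have hmono : V.enlarge π ≤ V.enlarge π' := Box.enlarge_mono le_rfl hπ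
  refine ⟨hW.le.trans (W.le_join_left W'), Box.join_le (hW.le_enlarge.trans hmono) hW'.le_enlarge,
    fun W'' h₁ h₂ => le_trans ?_ (hW'.cost_le W'' h₁ h₂)⟩
  set M := Box.meet hW.le hW'.le with hM
  have hMW : M ≤ W := Box.meet_le_left _ _
  have h₃ := hW.cost_le M (Box.le_meet _ _) (hMW.trans hW.le_enlarge)
  have h₄ := Box.width_join_add_width_meet hW.le hW'.le
  have hD : M.width ≤ W.width := Box.width_mono hMW
  rw [← hM] at h₄
  simp only [Sites.cost] at h₃ ⊢
  have hsub : V.nbhd π ⊆ V.nbhd π' := Box.openSet_mono hmono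
  have h₅ : ∑ z ∈ T.pts with z ∈ V.nbhd π, (weight T.cap z W - weight T.cap z M) * T.mult z ≤
      ∑ z ∈ T.pts with z ∈ V.nbhd π', (weight T.cap z W - weight T.cap z M) * T.mult z := by
    refine Finset.sum_le_sum_of_subset_of_nonneg ?_ ?_
    · intro z hz
      rw [Finset.mem_filter] at hz ⊢
      exact ⟨hz.1, hsub hz.2⟩
    · intro z _ _
      exact mul_nonneg (sub_nonneg.2 (weight_mono _ _ hMW)) (Nat.cast_nonneg _)
  have h₆ : ∑ z ∈ T.pts with z ∈ V.nbhd π', (weight T.cap z W - weight T.cap z M) * T.mult z ≤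
      ∑ z ∈ T.pts with z ∈ V.nbhd π',
        (weight T.cap z (W.join W') - weight T.cap z W') * T.mult z := by
    refine Finset.sum_le_sum fun z _ => mul_le_mul_of_nonneg_right ?_ (Nat.cast_nonneg _)
    have := weight_add_le T.cap z hW.le hW'.le
    linarith
  simp only [sub_mul, Finset.sum_sub_distrib] at h₅ h₆
  set a := ∑ z ∈ T.pts with z ∈ V.nbhd π, weight T.cap z W * T.mult z
  set b := ∑ z ∈ T.pts with z ∈ V.nbhd π, weight T.cap z M * T.mult z
  set c := ∑ z ∈ T.pts with z ∈ V.nbhd π', weight T.cap z (W.join W') * T.mult z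
  set d := ∑ z ∈ T.pts with z ∈ V.nbhd π', weight T.cap z W' * T.mult z
  have h₇ : (1 - α) * (W.width - M.width) ≤ α * (a - b) := by linarith
  have h₈ : a - b ≤ c - d := by linarith
  have h₉ : 0 ≤ a - b := by
    have : b ≤ a := Finset.sum_le_sum fun z _ =>
      mul_le_mul_of_nonneg_right (weight_mono _ _ hMW) (Nat.cast_nonneg _)
    linarith
  have e₁ : α * (a - b) ≤ α' * (a - b) := mul_le_mul_of_nonneg_right hα h₉
  have e₂ : α' * (a - b) ≤ α' * (c - d) := mul_le_mul_of_nonneg_left h₈ (h0.trans hα)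
  have e₃ : (1 - α') * (W.width - M.width) ≤ (1 - α) * (W.width - M.width) :=
    mul_le_mul_of_nonneg_right (by linarith) (by linarith)
  have e₄ : (W.join W').width - W'.width = W.width - M.width := by linarith
  have e₅ : (1 - α') * ((W.join W').width - W'.width) ≤ α' * (c - d) := by rw [e₄]; linarith
  linarith

theorem Sites.exists_isLargestOptimal (T : Sites n) {α : ℝ} (h0 : 0 ≤ α) (V : Box n)
    (π : ℝ≥0) : ∃ W, T.IsLargestOptimal α V π W := by
  classical
  let A : Set ((Fin n → ℝ) × (Fin n → ℝ)) :=
    Set.Icc ((V.enlarge π).lo, V.hi) (V.lo, (V.enlarge π).hi)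
  have hA : IsCompact A := isCompact_Icc
  let f : (Fin n → ℝ) × (Fin n → ℝ) → ℝ := fun p =>
    -α * ∑ z ∈ T.pts with z ∈ V.nbhd π, (Finset.univ : Finset (Fin n)).fold min T.cap
      (fun i => min (z i - p.1 i) (p.2 i - z i)) * T.mult z + (1 - α) * ∑ i, (p.2 i - p.1 i)
  have hfold : ∀ (z : Pt n) (s : Finset (Fin n)), Continuous
      fun p : (Fin n → ℝ) × (Fin n → ℝ) =>
        s.fold min T.cap (fun i => min (z i - p.1 i) (p.2 i - z i)) := by
    intro z s
    induction s using Finset.induction_on with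
    | empty => simpa using continuous_const
    | insert a s ha ih =>
      simp only [Finset.fold_insert ha]
      exact Continuous.min (by fun_prop) ih
  have hf : Continuous f := by
    refine Continuous.add (Continuous.mul continuous_const (continuous_finsetSum _ fun z _ => ?_))
      (by fun_prop)
    exact (hfold z _).mul continuous_const
  have hmem : ∀ W : Box n, V ≤ W → W ≤ V.enlarge π → (W.lo, W.hi) ∈ A := fun W h₁ h₂ =>
    ⟨⟨fun i => (h₂ i).1, fun i => (h₁ i).2⟩, ⟨fun i => (h₁ i).1, fun i => (h₂ i).2⟩⟩
  have hle : ∀ p ∈ A, ∀ i, p.1 i ≤ p.2 i := fun p hp i =>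
    (hp.2.1 i).trans ((V.lo_le_hi i).trans (hp.1.2 i))
  obtain ⟨p₀, hp₀, hmin⟩ := hA.exists_isMinOn
    ⟨(V.lo, V.hi), hmem V le_rfl (V.le_enlarge π)⟩ hf.continuousOn
  have hB : IsCompact (A ∩ {p | f p ≤ f p₀}) :=
    hA.inter_right (isClosed_le hf continuous_const)
  have hg : Continuous fun p : (Fin n → ℝ) × (Fin n → ℝ) => ∑ i, (p.2 i - p.1 i) := by fun_prop
  obtain ⟨p, hp, hmax⟩ := hB.exists_isMaxOn ⟨p₀, hp₀, le_refl (f p₀)⟩ hg.continuousOn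
  let W : Box n := ⟨p.1, p.2, hle p hp.1⟩
  have hW : T.IsOptimal α V π W := by
    refine ⟨fun i => ⟨hp.1.2.1 i, hp.1.1.2 i⟩, fun i => ⟨hp.1.1.1 i, hp.1.2.2 i⟩, ?_⟩
    intro W' h₁ h₂
    have h₃ : f p₀ ≤ f (W'.lo, W'.hi) := hmin (hmem W' h₁ h₂)
    have h₄ : f p ≤ f (W'.lo, W'.hi) := le_trans hp.2 h₃
    exact h₄
  refine ⟨W, hW, fun W' hW' => ?_⟩
  have hJ := hW'.join h0 le_rfl le_rfl hW
  have h₅ : f ((W'.join W).lo, (W'.join W).hi) ≤ f p₀ :=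
    hJ.cost_le ⟨p₀.1, p₀.2, hle p₀ hp₀⟩ (fun i => ⟨hp₀.2.1 i, hp₀.1.2 i⟩)
      (fun i => ⟨hp₀.1.1 i, hp₀.2.2 i⟩)
  have h₆ : (W'.join W).width ≤ W.width := hmax ⟨hmem _ hJ.le hJ.le_enlarge, h₅⟩
  have h₇ := Box.eq_of_le_of_width_le (W'.le_join_right W) h₆
  rw [h₇]
  exact W'.le_join_left W

/-- The largest optimal solution `M` for the input box `V` and the neighborhood `B(V, π)`. -/
def Sites.largest (T : Sites n) (α : unitInterval) (V : Box n) (π : ℝ≥0) : Box n :=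
  (T.exists_isLargestOptimal α.2.1 V π).choose

theorem Sites.largest_spec (T : Sites n) (α : unitInterval) (V : Box n) (π : ℝ≥0) :
    T.IsLargestOptimal α V π (T.largest α V π) :=
  (T.exists_isLargestOptimal α.2.1 V π).choose_spec

theorem Sites.largest_mono (T : Sites n) {α α' : unitInterval} (hα : α ≤ α') (V : Box n)
    {π π' : ℝ≥0} (hπ : π ≤ π') : T.largest α V π ≤ T.largest α' V π' :=
  (Box.le_join_left _ _).trans ((T.largest_spec α' V π').le_of_isOptimal _
    ((T.largest_spec α V π).isOptimal.join α.2.1 hα hπ (T.largest_spec α' V π').isOptimal))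

/-! ### Box filtrations and their persistence modules -/

/-- The parameters `(r, π, α)`: enlargement `r ≥ 0`, neighborhood size `π ≥ 0` and `α ∈ [0, 1]`. -/
@[ext]
structure Param where
  r : ℝ≥0
  π : ℝ≥0
  α : unitInterval

/-- The product order on the parameters. -/
instance : PartialOrder Param where
  le p q := p.r ≤ q.r ∧ p.π ≤ q.π ∧ p.α ≤ q.α
  le_refl p := ⟨le_refl _, le_refl _, le_refl _⟩
  le_trans p q s h₁ h₂ := ⟨h₁.1.trans h₂.1, h₁.2.1.trans h₂.2.1, h₁.2.2.trans h₂.2.2⟩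
  le_antisymm p q h₁ h₂ :=
    Param.ext (le_antisymm h₁.1 h₂.1) (le_antisymm h₁.2.1 h₂.2.1) (le_antisymm h₁.2.2 h₂.2.2)

/-- The shift `(r, π, α) ↦ (r + δ, π + δ, min (α + δ) 1)`. -/
def shift (δ : ℝ≥0) (p : Param) : Param where
  r := p.r + δ
  π := p.π + δ
  α := ⟨min (p.α + δ) 1, le_min (add_nonneg p.α.2.1 δ.2) zero_le_one, min_le_right _ _⟩

theorem shift_mono (δ : ℝ≥0) : Monotone (shift δ) := by
  rintro p q ⟨h₁, h₂, h₃⟩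
  refine ⟨add_le_add_left h₁ δ, add_le_add_left h₂ δ, ?_⟩
  exact min_le_min (add_le_add_left (Subtype.coe_le_coe.2 h₃) _) le_rfl

theorem le_shift (δ : ℝ≥0) (p : Param) : p ≤ shift δ p :=
  ⟨le_self_add, le_self_add, le_min (le_add_of_nonneg_right δ.2) p.α.2.2⟩

/-- The box filtration with vertex set the sites: a finite nonempty set of sites `x` is a simplex
of the complex at `(r, π, α)` if the boxes obtained by enlarging the largest optimal solutions for
the input boxes `V x` by `r` in both directions of each coordinate have a common point. For `r = 0`
this is the nerve of the largest optimal solutions. -/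
def boxComplex (T : Sites n) (V : Pt n → Box n) (p : Param) :
    PreAbstractSimplicialComplex T.pts where
  faces := {τ | τ.Nonempty ∧
    ∃ z : Pt n, ∀ x ∈ τ, z ∈ ((T.largest p.α (V x) p.π).enlarge p.r).toSet}
  isRelLowerSet_faces := by
    rintro τ ⟨hτ, z, hz⟩
    exact ⟨hτ, fun τ' hle hne => ⟨hne, z, fun x hx => hz x (hle hx)⟩⟩

theorem boxComplex_mono (T : Sites n) (V : Pt n → Box n) : Monotone (boxComplex T V) := by
  rintro p q ⟨h₁, h₂, h₃⟩ τ ⟨hτ, z, hz⟩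
  exact ⟨hτ, z, fun x hx =>
    Box.toSet_mono (Box.enlarge_mono (T.largest_mono h₃ (V x) h₂) h₁) (hz x hx)⟩

open scoped Classical in
/-- The simplicial set of ordered simplices of an abstract simplicial complex `K`: its
`m`-simplices are the tuples `(v₀, …, vₘ)`, repetitions allowed, such that `{v₀, …, vₘ}` is a
simplex of `K`. Its homology is the simplicial homology of `K`. -/
def orderedSimplices (ι : Type) : PreAbstractSimplicialComplex ι ⥤ SSet.{0} where
  obj K :=
    { obj m := {v : Fin (m.unop.len + 1) → ι // Finset.univ.image v ∈ K.faces}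
      map g := ↾fun v => ⟨v.1 ∘ g.unop.toOrderHom, (K.isRelLowerSet_faces v.2).2
        (by
          intro x hx
          obtain ⟨j, _, rfl⟩ := Finset.mem_image.1 hx
          exact Finset.mem_image_of_mem v.1 (Finset.mem_univ (g.unop.toOrderHom j)))
        ((Finset.univ_nonempty).image _)⟩
      map_id _ := rfl
      map_comp _ _ := rfl }
  map h := { app _ := ↾fun v => ⟨v.1, h.le v.2⟩ }

universe u

/-- A persistence module over the parameters `(r, π, α)`. -/
abbrev PersistenceModule (𝕜 : Type u) [Field 𝕜] := Param ⥤ ModuleCat.{u} 𝕜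

/-- The persistence module given by the homology, in degree `d` and with coefficients in the field
`𝕜`, of the box filtration. -/
def boxModule (𝕜 : Type u) [Field 𝕜] (d : ℕ) (T : Sites n) (V : Pt n → Box n) :
    PersistenceModule 𝕜 :=
  (boxComplex_mono T V).functor ⋙ orderedSimplices T.pts ⋙
    SSet.homologyFunctor (ModuleCat.of 𝕜 𝕜) d

/-- `A` and `B` are `δ`-interleaved: there are natural maps `A_p → B_{p + δ}` and
`B_p → A_{p + δ}` whose composites are the structure maps `A_p → A_{p + 2δ}` and
`B_p → B_{p + 2δ}`. -/
def Interleaved {𝕜 : Type u} [Field 𝕜] (δ : ℝ≥0) (A B : PersistenceModule 𝕜) : Prop :=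
  ∃ (φ : A ⟶ (shift_mono δ).functor ⋙ B) (ψ : B ⟶ (shift_mono δ).functor ⋙ A),
    (∀ p, φ.app p ≫ ψ.app (shift δ p) =
      A.map (homOfLE ((le_shift δ p).trans (le_shift δ (shift δ p))))) ∧
    (∀ p, ψ.app p ≫ φ.app (shift δ p) =
      B.map (homOfLE ((le_shift δ p).trans (le_shift δ (shift δ p)))))

/-! ### Point covers and pixel covers -/

/-- The sites of the point cover: the points of `X`, with weights at most `0`. -/
def pointSites (X : Finset (Pt n)) : Sites n where
  pts := X
  mult _ := 1
  cap := 0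

/-- The centroid `m_σ` of the pixel `σ = ∏ [oᵢ + kᵢ H, oᵢ + (kᵢ + 1) H)`, `k ∈ ℤⁿ`, that contains
`x`, for the grid of pixels with side length `H` and origin `o`. -/
def centroid (o : Pt n) (H : ℝ) (x : Pt n) : Pt n :=
  WithLp.toLp 2 fun i => o i + H * (⌊(x i - o i) / H⌋ + 1 / 2)

open scoped Classical in
/-- The pixel discretization of `X`: the set of the centroids of the nonempty pixels, with the
Euclidean distance between centroids. -/
def pixelDiscretization (o : Pt n) (H : ℝ) (X : Finset (Pt n)) : Finset (Pt n) :=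
  X.image (centroid o H)

instance (o : Pt n) (H : ℝ) (X : Finset (Pt n)) [h : Nonempty X] :
    Nonempty (pixelDiscretization o H X) := by
  classical
  obtain ⟨x, hx⟩ := h
  exact ⟨centroid o H x, Finset.mem_image_of_mem _ hx⟩

open scoped Classical in
/-- The sites of the pixel cover: the centroids of the nonempty pixels, counted with the number of
points of `X` in the pixel, with weights at most half of the side length. -/
def pixelSites (o : Pt n) (H : ℝ) (X : Finset (Pt n)) : Sites n where
  pts := pixelDiscretization o H X
  mult m := (X.filter fun x => centroid o H x = m).card
  cap := H / 2

open scoped Classical in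
/-- The distribution property of the points of `X` with constants `L` and `c`: the number
`θ(Q \ P)` of points between two nested open boxes `P ⊆ Q` is at most `L (|Q| - |P|) + 2 c n`. -/
def PointDistribution (L c : ℝ) (X : Finset (Pt n)) : Prop :=
  ∀ P Q : Box n, P ≤ Q →
    ((X.filter fun x => x ∈ Q.openSet ∧ x ∉ P.openSet).card : ℝ) ≤
      L * (Q.width - P.width) + 2 * c * n

end BoxFiltration

end

/-!
The box filtrations of the points and of the pixels are compared on a common index: every site is
the image of a point `x` under a map `f` (the identity, respectively the centroid of the pixel)
that moves points by at most `H / 2` in each coordinate, and multiplicities count preimages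
(`Sites.IsImage`). Corresponding sites have the same input box, so the interleaving reduces to
nesting largest optimal boxes up to the shift: `M_p ⊆ (M'_{p + δ})^δ`, in both directions
(`interleaved_of_largest_le`). The maps between the complexes come from `x ↦ f x` and a section of
it. Their composites are contiguous to the inclusions, and contiguous maps are homotopic
(`vertexHomotopy`), so they agree in homology.

For the nesting, let `M` be optimal for `α` and `M'` optimal for `α' = α + δ < 1`, and put
`Δ = |M ∪ M'| - |M'| = |M| - |M ∩ M'|`, where `M ∪ M'` is the smallest box containing both.
Optimality of `M` against `M ∩ M'` and of `M'` against `M ∪ M'` bounds the same width `Δ` from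
above and below by changes of the covered weight. The weights are supermodular, hence the two
changes differ only by the discretization errors, at most `H` for each point whose weight changes.
Because of the factors `α` and `α'` this gives `δ Δ ≤ H α K`, where `K` is the number of
these points (`Sites.IsOptimal.sub_mul_width_le`).

The number `K` is controlled although the boxes are arbitrarily large. A site in the neighborhood
that `M` does not cover would profit from moving all faces outwards, so optimality allows at most
`2 n / α` such points (`Sites.IsOptimal.card_notMem_le`). Every other point whose weight changes
lies between nested boxes whose widths differ by `Δ` and a multiple of `H`, and the point distribution
applies (`Sites.IsOptimal.card_weight_ne_le`). Altogether `δ Δ ≤ H (B + L Δ)` for a constant `B`,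
and with `H ≤ ε` and `δ` a large multiple of `√ε` this forces `Δ ≤ δ`, so that
`M ∪ M' ⊆ (M')^δ`. If `α + δ ≥ 1`, the width is not penalized after the shift and `M'` is the whole
neighborhood.
-/

namespace BoxFiltration

variable {n : ℕ}

/-! ### Contiguous simplicial maps -/

section Contiguity

variable {ι ι' : Type} {K : PreAbstractSimplicialComplex ι} {K' : PreAbstractSimplicialComplex ι'}

open scoped Classical in
/-- The map of simplicial sets of ordered simplices induced by a simplicial map, that is, by a map
of vertices that sends faces to faces. Instead of the image of a face, the hypothesis speaks of the
nonempty sets of vertices in it; this is equivalent and needs no decidable equality. -/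
def vertexMap (f : ι → ι') (hf : ∀ τ ∈ K.faces, ∀ τ' : Finset ι', τ'.Nonempty →
      (∀ y ∈ τ', ∃ x ∈ τ, f x = y) → τ' ∈ K'.faces) :
    (orderedSimplices ι).obj K ⟶ (orderedSimplices ι').obj K' where
  app m := ↾fun v => ⟨f ∘ v.1, hf _ v.2 _ (Finset.univ_nonempty.image _) (by simp)⟩
  naturality _ _ _ := rfl

open scoped Classical in
/-- Contiguous simplicial maps are homotopic: on an ordered simplex of the prism, apply `f` to the
vertices that lie over `0` and `g` to those that lie over `1`. -/
noncomputable def vertexHomotopy (f g : ι → ι')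
    (hf : ∀ τ ∈ K.faces, ∀ τ' : Finset ι', τ'.Nonempty →
      (∀ y ∈ τ', ∃ x ∈ τ, f x = y) → τ' ∈ K'.faces)
    (hg : ∀ τ ∈ K.faces, ∀ τ' : Finset ι', τ'.Nonempty →
      (∀ y ∈ τ', ∃ x ∈ τ, g x = y) → τ' ∈ K'.faces)
    (h : ∀ τ ∈ K.faces, ∀ τ' : Finset ι', τ'.Nonempty →
      (∀ y ∈ τ', ∃ x ∈ τ, f x = y ∨ g x = y) → τ' ∈ K'.faces) :
    SSet.Homotopy (vertexMap f hf) (vertexMap g hg) where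
  h :=
    { app m := ↾fun v => ⟨fun j =>
        if (SSet.stdSimplex.objEquiv v.2).toOrderHom j = 0 then f (v.1.1 j) else g (v.1.1 j),
        h _ v.1.2 _ (Finset.univ_nonempty.image _) (by
          intro y hy
          obtain ⟨j, _, rfl⟩ := Finset.mem_image.1 hy
          refine ⟨v.1.1 j, Finset.mem_image_of_mem _ (Finset.mem_univ j), ?_⟩
          split_ifs
          · exact Or.inl rfl
          · exact Or.inr rfl)⟩
      naturality _ _ _ := rfl }
  h₀ := rfl
  h₁ := rfl
  -- The homotopy is relative to the empty subcomplex.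
  rel := by
    ext m x
    exact x.1.2.elim

end Contiguity

/-! ### Maps of box complexes -/

/-- A map of sites is simplicial from the box complex at `p` to that at `q` if it enlarges the
boxes. -/
theorem mem_boxComplex_of_enlarge_le {T T' : Sites n} {V V' : Pt n → Box n} {p q : Param}
    (f : T.pts → T'.pts)
    (h : ∀ x : T.pts, (T.largest p.α (V x) p.π).enlarge p.r ≤
      (T'.largest q.α (V' (f x)) q.π).enlarge q.r)
    (τ : Finset T.pts) (hτ : τ ∈ (boxComplex T V p).faces) (τ' : Finset T'.pts)
    (hne : τ'.Nonempty) (hτ' : ∀ y ∈ τ', ∃ x ∈ τ, f x = y) :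
    τ' ∈ (boxComplex T' V' q).faces := by
  obtain ⟨_, z, hz⟩ := hτ
  refine ⟨hne, z, fun y hy => ?_⟩
  obtain ⟨x, hx, rfl⟩ := hτ' y hy
  exact Box.toSet_mono (h x) (hz x hx)

universe u

/-- The map in homology induced by a map of sites that enlarges the boxes. -/
noncomputable def siteMap (𝕜 : Type u) [Field 𝕜] (d : ℕ) {T T' : Sites n} {V V' : Pt n → Box n}
    {p q : Param} (f : T.pts → T'.pts)
    (h : ∀ x : T.pts, (T.largest p.α (V x) p.π).enlarge p.r ≤
      (T'.largest q.α (V' (f x)) q.π).enlarge q.r) :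
    (boxModule 𝕜 d T V).obj p ⟶ (boxModule 𝕜 d T' V').obj q :=
  SSet.homologyMap (vertexMap (K := boxComplex T V p) (K' := boxComplex T' V' q) f
    (mem_boxComplex_of_enlarge_le f h)) (ModuleCat.of 𝕜 𝕜) d

theorem siteMap_comp (𝕜 : Type u) [Field 𝕜] (d : ℕ) {T T' T'' : Sites n}
    {V V' V'' : Pt n → Box n} {p q s : Param} (f : T.pts → T'.pts) (g : T'.pts → T''.pts)
    (hf : ∀ x : T.pts, (T.largest p.α (V x) p.π).enlarge p.r ≤
      (T'.largest q.α (V' (f x)) q.π).enlarge q.r)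
    (hg : ∀ x : T'.pts, (T'.largest q.α (V' x) q.π).enlarge q.r ≤
      (T''.largest s.α (V'' (g x)) s.π).enlarge s.r) :
    siteMap 𝕜 d f hf ≫ siteMap 𝕜 d g hg =
      siteMap (V := V) (V' := V'') 𝕜 d (g ∘ f) fun x => (hf x).trans (hg (f x)) :=
  (SSet.homologyMap_comp _ _ _ _ _ _ _).symm

theorem boxModule_map_eq_siteMap (𝕜 : Type u) [Field 𝕜] (d : ℕ) (T : Sites n) (V : Pt n → Box n)
    {p q : Param} (h : p ⟶ q) :
    (boxModule 𝕜 d T V).map h = siteMap (V := V) (V' := V) 𝕜 d (id : T.pts → T.pts) fun _ =>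
      Box.enlarge_mono (T.largest_mono (leOfHom h).2.2 _ (leOfHom h).2.1) (leOfHom h).1 :=
  rfl

/-- Two maps of sites that enlarge the boxes are contiguous: a common point of the boxes of a
simplex also lies in the boxes of its images under both maps. So they agree in homology. -/
theorem siteMap_congr (𝕜 : Type u) [Field 𝕜] (d : ℕ) {T T' : Sites n}
    {V V' : Pt n → Box n} {p q : Param} (f g : T.pts → T'.pts)
    (hf : ∀ x : T.pts, (T.largest p.α (V x) p.π).enlarge p.r ≤
      (T'.largest q.α (V' (f x)) q.π).enlarge q.r)
    (hg : ∀ x : T.pts, (T.largest p.α (V x) p.π).enlarge p.r ≤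
      (T'.largest q.α (V' (g x)) q.π).enlarge q.r) :
    siteMap 𝕜 d f hf = siteMap 𝕜 d g hg := by
  refine SSet.Homotopy.congr_homologyMap (vertexHomotopy f g _ _ ?_) (ModuleCat.of 𝕜 𝕜) d
  rintro τ ⟨_, z, hz⟩ τ' hne hτ'
  refine ⟨hne, z, fun y hy => ?_⟩
  obtain ⟨x, hx, rfl | rfl⟩ := hτ' y hy
  · exact Box.toSet_mono (hf x) (hz x hx)
  · exact Box.toSet_mono (hg x) (hz x hx)

theorem siteMap_naturality (𝕜 : Type u) [Field 𝕜] (d : ℕ) {T T' : Sites n}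
    {V V' : Pt n → Box n} {p q p' q' : Param} (f : T.pts → T'.pts) (h : p ⟶ q) (h' : p' ⟶ q')
    (hp : ∀ x : T.pts, (T.largest p.α (V x) p.π).enlarge p.r ≤
      (T'.largest p'.α (V' (f x)) p'.π).enlarge p'.r)
    (hq : ∀ x : T.pts, (T.largest q.α (V x) q.π).enlarge q.r ≤
      (T'.largest q'.α (V' (f x)) q'.π).enlarge q'.r) :
    (boxModule 𝕜 d T V).map h ≫ siteMap 𝕜 d f hq =
      siteMap 𝕜 d f hp ≫ (boxModule 𝕜 d T' V').map h' := by
  rw [boxModule_map_eq_siteMap, boxModule_map_eq_siteMap, siteMap_comp, siteMap_comp]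
  rfl

theorem siteMap_comp_eq_map (𝕜 : Type u) [Field 𝕜] (d : ℕ) {T T' : Sites n}
    {V V' : Pt n → Box n} {p q s : Param} (f : T.pts → T'.pts) (g : T'.pts → T.pts)
    (hf : ∀ x : T.pts, (T.largest p.α (V x) p.π).enlarge p.r ≤
      (T'.largest q.α (V' (f x)) q.π).enlarge q.r)
    (hg : ∀ x : T'.pts, (T'.largest q.α (V' x) q.π).enlarge q.r ≤
      (T.largest s.α (V (g x)) s.π).enlarge s.r) (h : p ⟶ s) :
    siteMap 𝕜 d f hf ≫ siteMap 𝕜 d g hg = (boxModule 𝕜 d T V).map h := by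
  rw [boxModule_map_eq_siteMap, siteMap_comp]
  exact siteMap_congr ..

theorem interleaved_of_maps {𝕜 : Type u} [Field 𝕜] {δ : ℝ≥0} {A B : PersistenceModule 𝕜}
    (φ : ∀ p, A.obj p ⟶ B.obj (shift δ p)) (ψ : ∀ p, B.obj p ⟶ A.obj (shift δ p))
    (hφ : ∀ {p q} (h : p ⟶ q) (h' : shift δ p ⟶ shift δ q), A.map h ≫ φ q = φ p ≫ B.map h')
    (hψ : ∀ {p q} (h : p ⟶ q) (h' : shift δ p ⟶ shift δ q), B.map h ≫ ψ q = ψ p ≫ A.map h')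
    (hφψ : ∀ (p) (h : p ⟶ shift δ (shift δ p)), φ p ≫ ψ (shift δ p) = A.map h)
    (hψφ : ∀ (p) (h : p ⟶ shift δ (shift δ p)), ψ p ≫ φ (shift δ p) = B.map h) :
    Interleaved δ A B :=
  ⟨{ app := φ, naturality _ _ h := hφ h _ }, { app := ψ, naturality _ _ h := hψ h _ },
    fun p => hφψ p _, fun p => hψφ p _⟩

/-- Box filtrations are interleaved if their sites correspond to each other in such a way that
corresponding sites have the same input box and largest optimal boxes that are nested up to the
shift of the parameters. -/
theorem interleaved_of_largest_le (𝕜 : Type u) [Field 𝕜] (d : ℕ) {T T' : Sites n}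
    {V V' : Pt n → Box n} (δ : ℝ≥0) (f : T.pts → T'.pts) (g : T'.pts → T.pts)
    (hf : ∀ x : T.pts, V' (f x) = V x) (hg : ∀ y : T'.pts, V (g y) = V' y)
    (h : ∀ (x : T.pts) (p : Param), T.largest p.α (V x) p.π ≤
      (T'.largest (shift δ p).α (V x) (shift δ p).π).enlarge δ)
    (h' : ∀ (y : T'.pts) (p : Param), T'.largest p.α (V' y) p.π ≤
      (T.largest (shift δ p).α (V' y) (shift δ p).π).enlarge δ) :
    Interleaved δ (boxModule 𝕜 d T V) (boxModule 𝕜 d T' V') := by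
  have add : ∀ {P Q : Box n} (r : ℝ≥0), P ≤ Q.enlarge δ → P.enlarge r ≤ Q.enlarge (r + δ) := by
    intro P Q r hPQ i
    have := hPQ i
    simp only [Box.enlarge, NNReal.coe_add] at this ⊢
    constructor <;> linarith
  have hF : ∀ (p : Param) (x : T.pts), (T.largest p.α (V x) p.π).enlarge p.r ≤
      (T'.largest (shift δ p).α (V' (f x)) (shift δ p).π).enlarge (shift δ p).r := by
    intro p x
    rw [hf]
    exact add p.r (h x p)
  have hG : ∀ (p : Param) (y : T'.pts), (T'.largest p.α (V' y) p.π).enlarge p.r ≤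
      (T.largest (shift δ p).α (V (g y)) (shift δ p).π).enlarge (shift δ p).r := by
    intro p y
    rw [hg]
    exact add p.r (h' y p)
  exact interleaved_of_maps (fun p => siteMap 𝕜 d f (hF p)) (fun p => siteMap 𝕜 d g (hG p))
    (fun h h' => siteMap_naturality 𝕜 d f h h' _ _)
    (fun h h' => siteMap_naturality 𝕜 d g h h' _ _)
    (fun _ h => siteMap_comp_eq_map 𝕜 d f g _ _ h) fun _ h => siteMap_comp_eq_map 𝕜 d g f _ _ h

/-! ### Weights -/

theorem le_weight_iff {a k : ℝ} {z : Pt n} {P : Box n} :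
    a ≤ weight k z P ↔ a ≤ k ∧ ∀ i, a ≤ z i - P.lo i ∧ a ≤ P.hi i - z i := by
  simp [weight, Finset.le_fold_min]

theorem weight_le_cap (k : ℝ) (z : Pt n) (P : Box n) : weight k z P ≤ k :=
  (le_weight_iff.1 le_rfl).1

theorem weight_le_weight_add {k k' h : ℝ} {z z' : Pt n} (hz : ∀ i, |z i - z' i| ≤ h)
    (hk : k ≤ k' + h) (P : Box n) : weight k z P ≤ weight k' z' P + h := by
  rw [← sub_le_iff_le_add, le_weight_iff]
  obtain ⟨h₀, h₁⟩ := (le_weight_iff (z := z) (P := P)).1 (le_refl (weight k z P))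
  refine ⟨by linarith, fun i => ?_⟩
  have h₂ := h₁ i
  have h₃ := abs_le.1 (hz i)
  constructor <;> linarith

theorem weight_neg_of_notMem {k : ℝ} {z : Pt n} {P : Box n} (hz : z ∉ P.toSet) :
    weight k z P < 0 := by
  by_contra! h
  refine hz fun i => ?_
  have := (le_weight_iff.1 h).2 i
  constructor <;> linarith

/-! ### Box operations -/

namespace Box

/-- The box `∏ [lᵢ + s, uᵢ - s]`, where a side shorter than `2 s` is replaced by its midpoint. -/
noncomputable def shrink (P : Box n) (s : ℝ≥0) : Box n where
  lo i := min (P.lo i + s) ((P.lo i + P.hi i) / 2)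
  hi i := max (P.hi i - s) ((P.lo i + P.hi i) / 2)
  lo_le_hi _ := (min_le_right _ _).trans (le_max_right _ _)

theorem shrink_le (P : Box n) (s : ℝ≥0) : P.shrink s ≤ P := by
  intro i
  have := P.lo_le_hi i
  have : (0 : ℝ) ≤ s := s.2
  exact ⟨le_min (by linarith) (by linarith), max_le (by linarith) (by linarith)⟩

theorem width_sub_le_width_shrink (P : Box n) (s : ℝ≥0) :
    P.width - 2 * n * s ≤ (P.shrink s).width := by
  have : P.width - 2 * n * s = ∑ i : Fin n, (P.hi i - P.lo i - 2 * s) := by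
    simp only [width, Finset.sum_sub_distrib, Finset.sum_const, Finset.card_univ,
      Fintype.card_fin, nsmul_eq_mul]
    ring
  rw [this]
  refine Finset.sum_le_sum fun i _ => ?_
  have h₁ := min_le_left (P.lo i + s) ((P.lo i + P.hi i) / 2)
  have h₂ := le_max_left (P.hi i - s) ((P.lo i + P.hi i) / 2)
  simp only [shrink]
  linarith

theorem of_mem_openSet_shrink {P : Box n} {s : ℝ≥0} {z : Pt n} (hz : z ∈ (P.shrink s).openSet)
    (i : Fin n) : P.lo i + s < z i ∧ z i < P.hi i - s := by
  obtain ⟨h₁, h₂⟩ := hz i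
  simp only [shrink, min_lt_iff, lt_max_iff] at h₁ h₂
  constructor
  · rcases h₁ with h₁ | h₁
    · exact h₁
    · rcases h₂ with h₂ | h₂ <;> linarith
  · rcases h₂ with h₂ | h₂
    · exact h₂
    · rcases h₁ with h₁ | h₁ <;> linarith

theorem width_enlarge (P : Box n) (s : ℝ≥0) : (P.enlarge s).width = P.width + 2 * n * s := by
  simp only [width, enlarge, Finset.sum_sub_distrib, Finset.sum_add_distrib, Finset.sum_const,
    Finset.card_univ, Fintype.card_fin, nsmul_eq_mul]
  ring

theorem le_enlarge_of_width_le {P Q : Box n} {δ : ℝ≥0} (h : P ≤ Q)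
    (hw : Q.width ≤ P.width + δ) : Q ≤ P.enlarge δ := by
  have h₀ : ∀ i ∈ Finset.univ, 0 ≤ (Q.hi i - Q.lo i) - (P.hi i - P.lo i) := by
    intro i _
    have := h i
    linarith
  intro i
  have h₁ := Finset.single_le_sum h₀ (Finset.mem_univ i)
  rw [Finset.sum_sub_distrib] at h₁
  simp only [width] at hw
  have h₂ := h i
  simp only [enlarge]
  constructor <;> linarith

end Box

/-! ### Optimality in terms of the points -/

open scoped Classical in
/-- The sites `T`, counted with multiplicity, are the images of the points of `X` under `f`. This is
expressed by the transfer of sums over the sites in a set to sums over points. -/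
def Sites.IsImage (T : Sites n) (X : Finset (Pt n)) (f : Pt n → Pt n) : Prop :=
  ∀ (N : Set (Pt n)) (φ : Pt n → ℝ),
    ∑ z ∈ T.pts with z ∈ N, φ z * T.mult z = ∑ x ∈ X with f x ∈ N, φ (f x)

theorem isImage_pointSites (X : Finset (Pt n)) : (pointSites X).IsImage X id := by
  intro N φ
  simp [pointSites]

theorem isImage_pixelSites (o : Pt n) (H : ℝ) (X : Finset (Pt n)) :
    (pixelSites o H X).IsImage X (centroid o H) := by
  classical
  intro N φ
  rw [Finset.sum_filter, Finset.sum_filter,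
    Finset.sum_comp (fun z => if z ∈ N then φ z else 0) (centroid o H)]
  simp only [pixelSites, pixelDiscretization]
  refine Finset.sum_congr (by congr) fun z _ => ?_
  split_ifs
  · rw [nsmul_eq_mul, mul_comm]
  · simp

variable {T : Sites n} {X : Finset (Pt n)} {f : Pt n → Pt n} {α : ℝ} {V M : Box n} {π : ℝ≥0}

open scoped Classical in
theorem Sites.IsOptimal.sum_weight_sub_le (hT : T.IsImage X f) (hM : T.IsOptimal α V π M)
    {W : Box n} (h₁ : V ≤ W) (h₂ : W ≤ V.enlarge π) :
    α * ∑ x ∈ X with f x ∈ V.nbhd π, (weight T.cap (f x) W - weight T.cap (f x) M) ≤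
      (1 - α) * (W.width - M.width) := by
  have := hM.cost_le W h₁ h₂
  simp only [Sites.cost] at this
  rw [hT _ (fun z => weight T.cap z W), hT _ (fun z => weight T.cap z M)] at this
  rw [Finset.sum_sub_distrib]
  linarith

open scoped Classical in
/-- An optimal box leaves few sites of its neighborhood uncovered: moving all faces outwards by a
small `t`, but not out of the neighborhood, increases the weight of each uncovered site by at least
`t`, and the width by at most `2 n t`. -/
theorem Sites.IsOptimal.card_notMem_le (hT : T.IsImage X f) (hcap : 0 ≤ T.cap) (h0 : 0 ≤ α)
    (h1 : α ≤ 1) (hM : T.IsOptimal α V π M) :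
    α * (X.filter fun x => f x ∈ V.nbhd π ∧ f x ∉ M.toSet).card ≤ 2 * n := by
  set S := X.filter fun x => f x ∈ V.nbhd π ∧ f x ∉ M.toSet with hS
  obtain ⟨t, ht, ht0⟩ : ∃ t : ℝ, (∀ x ∈ S, t ≤ -weight T.cap (f x) M) ∧ 0 < t := by
    have h₁ : ∀ᶠ t : ℝ in nhdsWithin 0 (Set.Ioi 0), ∀ x ∈ S, t ≤ -weight T.cap (f x) M := by
      rw [Finset.eventually_all]
      intro x hx
      have hx' := weight_neg_of_notMem (k := T.cap) (Finset.mem_filter.1 hx).2.2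
      exact nhdsWithin_le_nhds (eventually_le_nhds (by linarith))
    exact (h₁.and self_mem_nhdsWithin).exists
  let W : Box n :=
    { lo i := max (M.lo i - t) ((V.enlarge π).lo i)
      hi i := min (M.hi i + t) ((V.enlarge π).hi i)
      lo_le_hi i := by
        have := hM.le_enlarge i
        have := M.lo_le_hi i
        exact max_le (le_min (by linarith) (by linarith)) (le_min (by linarith) (by linarith)) }
  have hMW : M ≤ W := fun i =>
    ⟨max_le (by linarith) (hM.le_enlarge i).1, le_min (by linarith) (hM.le_enlarge i).2⟩
  have key := hM.sum_weight_sub_le hT (hM.le.trans hMW)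
    (fun i => ⟨le_max_right _ _, min_le_right _ _⟩ : W ≤ V.enlarge π)
  have hw : W.width - M.width ≤ 2 * n * t := by
    have : W.width ≤ ∑ i : Fin n, (M.hi i - M.lo i + 2 * t) := by
      refine Finset.sum_le_sum fun i _ => ?_
      have h₁ := le_max_left (M.lo i - t) ((V.enlarge π).lo i)
      have h₂ := min_le_left (M.hi i + t) ((V.enlarge π).hi i)
      simp only [W]
      linarith
    rw [Finset.sum_add_distrib, Finset.sum_const, Finset.card_univ, Fintype.card_fin,
      nsmul_eq_mul] at this
    simp only [Box.width] at this ⊢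
    linarith
  have hsum : S.card * t ≤ ∑ x ∈ X with f x ∈ V.nbhd π,
      (weight T.cap (f x) W - weight T.cap (f x) M) := by
    rw [← nsmul_eq_mul, ← Finset.sum_const]
    refine (Finset.sum_le_sum fun x hx => ?_).trans
      (Finset.sum_le_sum_of_subset_of_nonneg (s := S) ?_ fun x _ _ =>
        sub_nonneg.2 (weight_mono _ _ hMW))
    · have h₁ := ht x hx
      have h₂ := (Finset.mem_filter.1 hx).2.1
      rw [le_sub_iff_add_le, le_weight_iff]
      refine ⟨by linarith, fun i => ?_⟩
      obtain ⟨h₃, h₄⟩ :=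
        (le_weight_iff.1 (le_refl (weight T.cap (f x) M))).2 i
      obtain ⟨h₅, h₆⟩ := h₂ i
      constructor
      · rw [le_sub_comm]
        exact max_le (by linarith) (by linarith)
      · rw [le_sub_iff_add_le]
        exact le_min (by linarith) (by linarith)
    · intro x hx
      rw [hS, Finset.mem_filter] at hx
      exact Finset.mem_filter.2 ⟨hx.1, hx.2.1⟩
  have h₁ : α * (S.card * t) ≤ (1 - α) * (2 * n * t) :=
    (mul_le_mul_of_nonneg_left hsum h0).trans
      (key.trans (mul_le_mul_of_nonneg_left hw (by linarith)))
  have h₂ : (0 : ℝ) ≤ 2 * n := by positivity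
  have h₃ : α * S.card * t ≤ 2 * n * t := by nlinarith [mul_nonneg h0 (mul_nonneg h₂ ht0.le)]
  exact le_of_mul_le_mul_right h₃ ht0

/-! ### Comparison of largest optimal boxes -/

open scoped Classical in
/-- If `D` is contained in an optimal box `M`, few sites in the neighborhood have different weights
for `D` and `M`: such a site is not covered by `M`, or its point lies in a neighborhood of `M` and
not deep inside `D`, since well inside a box the weight is the cap. -/
theorem Sites.IsOptimal.card_weight_ne_le {T : Sites n} {X : Finset (Pt n)} {f : Pt n → Pt n}
    {α : ℝ} {V D M : Box n} {π : ℝ≥0} {L c : ℝ≥0} (hX : PointDistribution L c X)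
    (hT : T.IsImage X f) (h : ℝ≥0) (hh : 0 < h) (hcap : 0 ≤ T.cap) (hcap' : T.cap ≤ h)
    (hf : ∀ x ∈ X, ∀ i, |f x i - x i| ≤ h) (h0 : 0 ≤ α) (h1 : α ≤ 1)
    (hM : T.IsOptimal α V π M) (hD : D ≤ M) :
    α * (X.filter fun x => f x ∈ V.nbhd π ∧
        weight T.cap (f x) M ≠ weight T.cap (f x) D).card ≤
      2 * n + (L * (M.width - D.width + 8 * n * h) + 2 * c * n) := by
  have hh' : (0 : ℝ) < h := hh
  set s : ℝ≥0 := 2 * h with hs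
  have hs' : (s : ℝ) = 2 * h := by simp [hs]
  have hDM : D.shrink s ≤ M.enlarge s := (D.shrink_le s).trans (hD.trans (M.le_enlarge s))
  have h₁ := hM.card_notMem_le hT hcap h0 h1
  have h₂ := hX _ _ hDM
  have h₃ : (X.filter fun x => f x ∈ V.nbhd π ∧
        weight T.cap (f x) M ≠ weight T.cap (f x) D).card ≤
      (X.filter fun x => f x ∈ V.nbhd π ∧ f x ∉ M.toSet).card +
      (X.filter fun x => x ∈ (M.enlarge s).openSet ∧ x ∉ (D.shrink s).openSet).card := by
    refine (Finset.card_le_card fun x hx => ?_).trans (Finset.card_union_le _ _)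
    rw [Finset.mem_filter] at hx
    obtain ⟨hxX, hxN, hne⟩ := hx
    rw [Finset.mem_union, Finset.mem_filter, Finset.mem_filter]
    by_cases hxM : f x ∈ M.toSet
    · refine Or.inr ⟨hxX, fun i => ?_, fun hxD => hne ?_⟩
      · have := abs_le.1 (hf x hxX i)
        have := hxM i
        simp only [Box.enlarge, hs']
        constructor <;> linarith
      · have h₄ : T.cap ≤ weight T.cap (f x) D := by
          rw [le_weight_iff]
          refine ⟨le_rfl, fun i => ?_⟩
          have := Box.of_mem_openSet_shrink hxD i
          have := abs_le.1 (hf x hxX i)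
          rw [hs'] at *
          constructor <;> linarith
        have h₅ := weight_mono T.cap (f x) hD
        have h₆ := weight_le_cap T.cap (f x) M
        have h₇ := weight_le_cap T.cap (f x) D
        linarith
    · exact Or.inl ⟨hxX, hxN, hxM⟩
  have h₄ := D.width_sub_le_width_shrink s
  have h₅ : L * ((M.enlarge s).width - (D.shrink s).width) + 2 * c * n ≤
      L * (M.width - D.width + 8 * n * h) + 2 * c * n := by
    rw [Box.width_enlarge]
    have : M.width + 2 * n * s - (D.shrink s).width ≤ M.width - D.width + 8 * n * h := by
      rw [hs'] at *
      linarith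
    have := mul_le_mul_of_nonneg_left this L.2
    simpa using this
  set a := (X.filter fun x => f x ∈ V.nbhd π ∧ f x ∉ M.toSet).card
  set b := (X.filter fun x => x ∈ (M.enlarge s).openSet ∧ x ∉ (D.shrink s).openSet).card
  have h₆ : α * (b : ℝ) ≤ b := mul_le_of_le_one_left (Nat.cast_nonneg _) h1
  have h₇ : α * _ ≤ α * ((a + b : ℕ) : ℝ) := mul_le_mul_of_nonneg_left (Nat.cast_le.2 h₃) h0
  push_cast at h₇
  linarith

/-- Comparison of the optimal boxes `M` and `M'` of two linear programs, whose sites are both within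
`h` of the points: the width by which `M` exceeds `M'` is small. Intersecting `M` with `M'` does not
lower the cost for `α`, and joining `M` to `M'` does not lower the cost for `α'`. By
supermodularity of the weights, the two changes of the covered weight differ only by the errors in
the weights, at most `2 h` at each site whose weight changes at all, while the two factors of the
width differ by an amount of order `α' - α`. -/
theorem Sites.IsOptimal.sub_mul_width_le {T T' : Sites n} {X : Finset (Pt n)}
    {f f' : Pt n → Pt n} {α α' : ℝ} {V M M' : Box n} {π π' : ℝ≥0} {L c : ℝ≥0}
    (hX : PointDistribution L c X) (hT : T.IsImage X f) (hT' : T'.IsImage X f') (h : ℝ≥0)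
    (hh : 0 < h) (hcap : 0 ≤ T.cap) (hcap' : T.cap ≤ h) (hcap₁ : 0 ≤ T'.cap) (hcap₁' : T'.cap ≤ h)
    (hf : ∀ x ∈ X, ∀ i, |f x i - x i| ≤ h) (hff' : ∀ x ∈ X, ∀ i, |f x i - f' x i| ≤ h)
    (hN : ∀ x ∈ X, f x ∈ V.nbhd π → f' x ∈ V.nbhd π') (hπ : π ≤ π')
    (h0 : 0 ≤ α) (hα : α ≤ α') (h1 : α' ≤ 1)
    (hM : T.IsOptimal α V π M) (hM' : T'.IsOptimal α' V π' M') :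
    (α' - α) * ((M.join M').width - M'.width) ≤
      2 * h * (2 * n + (L * ((M.join M').width - M'.width + 8 * n * h) + 2 * c * n)) := by
  classical
  set D := Box.meet hM.le hM'.le
  set J := M.join M'
  have hDM : D ≤ M := Box.meet_le_left _ _
  have hM'J : M' ≤ J := Box.le_join_right _ _
  have hΔ : M.width - D.width = J.width - M'.width := by
    have : J.width + D.width = _ := Box.width_join_add_width_meet hM.le hM'.le
    linarith
  have hcount := hM.card_weight_ne_le hX hT h hh hcap hcap' hf h0 (hα.trans h1) hDM
  rw [hΔ] at hcount
  have h₁ := hM.sum_weight_sub_le hT (Box.le_meet hM.le hM'.le) (hDM.trans hM.le_enlarge)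
  have h₂ := hM'.sum_weight_sub_le hT' (hM'.le.trans hM'J)
    (Box.join_le (hM.le_enlarge.trans (Box.enlarge_mono le_rfl hπ)) hM'.le_enlarge)
  set K := (X.filter fun x => f x ∈ V.nbhd π ∧
        weight T.cap (f x) M ≠ weight T.cap (f x) D).card
  set S := ∑ x ∈ X with f x ∈ V.nbhd π, (weight T.cap (f x) D - weight T.cap (f x) M)
  set S' := ∑ x ∈ X with f' x ∈ V.nbhd π', (weight T'.cap (f' x) J - weight T'.cap (f' x) M')
  have h₃ : -S ≤ S' + 2 * h * K := by
    have hK : 2 * h * (K : ℝ) = ∑ x ∈ X with f x ∈ V.nbhd π,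
        if weight T.cap (f x) M ≠ weight T.cap (f x) D then 2 * (h : ℝ) else 0 := by
      rw [← Finset.sum_filter, Finset.filter_filter, Finset.sum_const, nsmul_eq_mul, mul_comm]
    have hS' : ∑ x ∈ X with f x ∈ V.nbhd π, (weight T'.cap (f' x) J - weight T'.cap (f' x) M') ≤
        S' := by
      refine Finset.sum_le_sum_of_subset_of_nonneg (fun x hx => ?_) fun x _ _ =>
        sub_nonneg.2 (weight_mono _ _ hM'J)
      rw [Finset.mem_filter] at hx ⊢
      exact ⟨hx.1, hN x hx.1 hx.2⟩
    refine le_trans ?_ (add_le_add_left hS' _)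
    rw [hK, ← Finset.sum_neg_distrib, ← Finset.sum_add_distrib]
    refine Finset.sum_le_sum fun x hx => ?_
    have hxX := (Finset.mem_filter.1 hx).1
    have e₀ := weight_mono T'.cap (f' x) hM'J
    split_ifs with hne
    · have e₁ : _ ≤ weight T.cap (f x) J + weight T.cap (f x) D :=
        weight_add_le T.cap (f x) hM.le hM'.le
      have e₂ := weight_le_weight_add (hff' x hxX) (by linarith : T.cap ≤ T'.cap + h) J
      have e₃ := weight_le_weight_add (z := f' x) (z' := f x)
        (fun i => by rw [abs_sub_comm]; exact hff' x hxX i) (by linarith : T'.cap ≤ T.cap + h) M'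
      linarith
    · rw [not_not] at hne
      linarith
  have e₁ : α' * ((1 - α) * (J.width - M'.width)) ≤ α' * (α * -S) :=
    mul_le_mul_of_nonneg_left (by rw [← hΔ]; linarith) (h0.trans hα)
  have e₂ : α' * α * -S ≤ α' * α * (S' + 2 * h * K) :=
    mul_le_mul_of_nonneg_left h₃ (mul_nonneg (h0.trans hα) h0)
  have e₃ := mul_le_mul_of_nonneg_left h₂ h0
  have e₄ : α' * (2 * h * (α * K)) ≤ 2 * h * (α * K) :=
    mul_le_of_le_one_left (by positivity) h1
  have e₅ := mul_le_mul_of_nonneg_left hcount (by positivity : (0 : ℝ) ≤ 2 * h)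
  linarith

/-- For `α = 1` the width is not penalized, so the largest optimal box is the closure of the
neighborhood. -/
theorem Sites.largest_one (T : Sites n) (V : Box n) (π : ℝ≥0) (α : unitInterval)
    (hα : (α : ℝ) = 1) : T.largest α V π = V.enlarge π := by
  have h := T.largest_spec α V π
  refine le_antisymm h.isOptimal.le_enlarge (h.le_of_isOptimal _ ⟨V.le_enlarge π, le_rfl, ?_⟩)
  intro W _ hW
  simp only [Sites.cost, hα, sub_self, zero_mul, add_zero, neg_mul, one_mul, neg_le_neg_iff]
  exact Finset.sum_le_sum fun z _ =>
    mul_le_mul_of_nonneg_right (weight_mono _ _ hW) (Nat.cast_nonneg _)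

/-- The constant `C` of the interleaving: for `B = 2 n + 2 c n + 4 n L`, the comparison of widths
reads `C Δ ≤ √ε B + L Δ`, from which `C = 1 + L + B` gives `Δ ≤ √ε`. -/
def interleavingConst (n : ℕ) (L c : ℝ≥0) : ℝ≥0 := 1 + L + (2 * n + 2 * c * n + 4 * n * L)

/-- The largest optimal boxes of two linear programs whose sites are within `H / 2` of the points
are nested up to the shift of the parameters. -/
theorem Sites.largest_le_enlarge_largest {T T' : Sites n} {X : Finset (Pt n)}
    {f f' : Pt n → Pt n} {L c : ℝ≥0} (hX : PointDistribution L c X) (hT : T.IsImage X f)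
    (hT' : T'.IsImage X f') {H : ℝ} {ε : ℝ≥0} (hH : 0 < H) (hHε : H * √(n : ℝ) ≤ ε)
    (hcap : 0 ≤ T.cap) (hcap' : T.cap ≤ H / 2) (hcap₁ : 0 ≤ T'.cap) (hcap₁' : T'.cap ≤ H / 2)
    (hf : ∀ x ∈ X, ∀ i, |f x i - x i| ≤ H / 2) (hff' : ∀ x ∈ X, ∀ i, |f x i - f' x i| ≤ H / 2)
    (V : Box n) (p : Param) {δ : ℝ≥0} (hδ : δ = interleavingConst n L c * max (NNReal.sqrt ε) ε) :
    T.largest p.α V p.π ≤ (T'.largest (shift δ p).α V (shift δ p).π).enlarge δ := by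
  rcases Nat.eq_zero_or_pos n with rfl | hn
  · exact fun i => i.elim0
  have hn' : (1 : ℝ) ≤ √(n : ℝ) := Real.one_le_sqrt.2 (by exact_mod_cast hn)
  have hHε' : H ≤ ε := le_trans (by nlinarith) hHε
  set B : ℝ := 2 * n + 2 * c * n + 4 * n * L with hB
  have hB0 : 0 ≤ B := by positivity
  have hL0 : (0 : ℝ) ≤ L := L.2
  have hC : (interleavingConst n L c : ℝ) = 1 + L + B := by simp [interleavingConst, hB]
  have hδ' : (δ : ℝ) = (1 + L + B) * max √(ε : ℝ) ε := by
    rw [hδ, NNReal.coe_mul, hC, NNReal.coe_max, Real.coe_sqrt]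
  have hmax : (max √(ε : ℝ) ε : ℝ) ≤ δ := by
    rw [hδ']
    exact le_mul_of_one_le_left (le_max_of_le_right ε.2) (by linarith)
  have hεδ : (ε : ℝ) ≤ δ := (le_max_right _ _).trans hmax
  have hM := (T.largest_spec p.α V p.π).isOptimal
  have hM' := (T'.largest_spec (shift δ p).α V (shift δ p).π).isOptimal
  rcases le_or_gt 1 ((p.α : ℝ) + δ) with hα | hα
  · rw [T'.largest_one V _ (shift δ p).α (min_eq_right hα)]
    exact (hM.le_enlarge.trans (Box.enlarge_mono le_rfl (le_shift δ p).2.1)).trans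
      (Box.le_enlarge _ _)
  have hα' : ((shift δ p).α : ℝ) = p.α + δ := min_eq_left hα.le
  -- As `δ < 1` here, also `ε < 1`, and `√ε` is the larger of `√ε` and `ε`.
  have hs1 : √(ε : ℝ) < 1 := by
    have := p.α.2.1
    exact ((le_max_left _ _).trans hmax).trans_lt (by linarith)
  have hs0 : 0 < √(ε : ℝ) := Real.sqrt_pos.2 (hH.trans_le hHε')
  have hsq : √(ε : ℝ) * √(ε : ℝ) = ε := Real.mul_self_sqrt ε.2
  have hmax' : max √(ε : ℝ) ε = √(ε : ℝ) := max_eq_left (by nlinarith)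
  rw [hmax'] at hδ' hmax
  obtain ⟨h, hh⟩ : ∃ h : ℝ≥0, (h : ℝ) = H / 2 :=
    ⟨(H / 2).toNNReal, Real.coe_toNNReal _ (by linarith)⟩
  simp only [← hh] at hcap' hcap₁' hf hff'
  have key := hM.sub_mul_width_le hX hT hT' h (by rw [← NNReal.coe_pos, hh]; linarith)
    hcap hcap' hcap₁ hcap₁' hf hff' (fun x hx hxN i => by
      have h₁ := abs_le.1 (hff' x hx i)
      have h₂ := hxN i
      simp only [Box.enlarge, shift, NNReal.coe_add] at h₂ ⊢
      constructor <;> linarith) (le_shift δ p).2.1 p.α.2.1 (le_shift δ p).2.2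
      (shift δ p).α.2.2 hM'
  set M := T.largest p.α V p.π
  set M' := T'.largest (shift δ p).α V (shift δ p).π
  refine (Box.le_join_left M M').trans (Box.le_enlarge_of_width_le (Box.le_join_right M M') ?_)
  set Δ := (M.join M').width - M'.width
  have hΔ0 : 0 ≤ Δ := sub_nonneg.2 (Box.width_mono (Box.le_join_right M M'))
  suffices Δ ≤ √(ε : ℝ) by linarith
  rw [hα', add_sub_cancel_left, hh, hδ'] at key
  set s := √(ε : ℝ)
  have e₁ : 2 * (H / 2) * (2 * n + (L * (Δ + 8 * n * (H / 2)) + 2 * c * n)) ≤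
      s * s * (B + L * Δ) := by
    rw [hsq]
    have : 2 * n + (L * (Δ + 8 * n * (H / 2)) + 2 * c * n) ≤ B + L * Δ := by
      have hH1 : H ≤ 1 := by nlinarith
      have : n * L * H ≤ n * L * (1 : ℝ) := mul_le_mul_of_nonneg_left hH1 (by positivity)
      rw [hB]
      linarith
    have hBL : 0 ≤ B + L * Δ := by positivity
    calc _ = H * (2 * n + (L * (Δ + 8 * n * (H / 2)) + 2 * c * n)) := by ring
      _ ≤ H * (B + L * Δ) := mul_le_mul_of_nonneg_left this hH.le
      _ ≤ _ := mul_le_mul_of_nonneg_right hHε' hBL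
  have e₂ : s * ((1 + L + B) * Δ) ≤ s * (s * B + s * (L * Δ)) := by linarith
  have e₃ := le_of_mul_le_mul_left e₂ hs0
  have e₄ : s * (L * Δ) ≤ L * Δ := mul_le_of_le_one_left (by positivity) hs1.le
  have e₅ : (1 + B) * Δ ≤ (1 + B) * s := by linarith
  exact le_of_mul_le_mul_left e₅ (by linarith)

theorem abs_centroid_sub_le (o : Pt n) {H : ℝ} (hH : 0 < H) (x : Pt n) (i : Fin n) :
    |centroid o H x i - x i| ≤ H / 2 := by
  have h₁ := Int.floor_le ((x i - o i) / H)
  have h₂ := (Int.lt_floor_add_one ((x i - o i) / H)).le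
  rw [le_div_iff₀ hH] at h₁
  rw [div_le_iff₀ hH] at h₂
  have : centroid o H x i = o i + H * (⌊(x i - o i) / H⌋ + 1 / 2) := rfl
  rw [this, abs_le]
  constructor <;> linarith

end BoxFiltration

open BoxFiltration in
theorem mainTheorem4 (n : ℕ) (L c : ℝ≥0) :
    ∃ C : ℝ≥0, ∀ (X : Finset (Pt n)) [Nonempty X], PointDistribution L c X →
      ∀ (o : Pt n) (H : ℝ) (ε : ℝ≥0), 0 < H → 0 < ε →
        H * √(n : ℝ) ≤ ε →
        GromovHausdorff.ghDist X (pixelDiscretization o H X) < ε →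
        0.5 * H * L < 1 →
        ∀ V Vbar : Pt n → Box n, (∀ x ∈ X, x ∈ (V x).toSet) →
          (∀ x ∈ X, Vbar (centroid o H x) = V x) →
          ∀ (𝕜 : Type*) [Field 𝕜] (d : ℕ),
            Interleaved (C * max (NNReal.sqrt ε) ε)
              (boxModule 𝕜 d (pointSites X) V) (boxModule 𝕜 d (pixelSites o H X) Vbar) := by
  classical
  refine ⟨interleavingConst n L c, ?_⟩
  intro X _ hX o H ε hH _ hHε _ _ V Vbar _ hV 𝕜 _ d
  have hsec : ∀ y : (pixelSites o H X).pts, ∃ x : (pointSites X).pts, centroid o H x = y := by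
    rintro ⟨y, hy⟩
    obtain ⟨x, hx, rfl⟩ := Finset.mem_image.1 hy
    exact ⟨⟨x, hx⟩, rfl⟩
  choose g hg using hsec
  refine interleaved_of_largest_le 𝕜 d _
    (fun x => ⟨centroid o H x, Finset.mem_image_of_mem _ x.2⟩) g (fun x => hV x x.2)
    (fun y => by rw [← hg y]; exact (hV _ (g y).2).symm) (fun x p => ?_) fun y p => ?_
  · refine Sites.largest_le_enlarge_largest hX (isImage_pointSites X) (isImage_pixelSites o H X)
      hH hHε le_rfl ?_ ?_ le_rfl ?_ ?_ _ p rfl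
    · exact (half_pos hH).le
    · exact (half_pos hH).le
    · intro x _ i
      simpa using (half_pos hH).le
    · intro x _ i
      rw [abs_sub_comm]
      exact abs_centroid_sub_le o hH x i
  · refine Sites.largest_le_enlarge_largest hX (isImage_pixelSites o H X) (isImage_pointSites X)
      hH hHε ?_ le_rfl le_rfl ?_ ?_ ?_ _ p rfl
    · exact (half_pos hH).le
    · exact (half_pos hH).le
    · exact fun x _ i => abs_centroid_sub_le o hH x i
    · exact fun x _ i => abs_centroid_sub_le o hH x i
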